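/- Let $V$ be a complex vector space with a countably infinite basis $(e_i)_{i\in\mathbb{N}}$, let $e^i\in V^*$ be the functionals with $e^i(e_j)=\delta_{ij}$, and let $V_*=\operatorname{span}\{e^i : i\in\mathbb{N}\}\subset V^*=\operatorname{Hom}(V,\mathbb{C})$. Let $$\mathfrak{gl}^M_\infty=\{\varphi\in\operatorname{End}(V) : \varphi^*(V_*)\subset V_*\},$$ a complex Lie algebra under the commutator bracket, where $\varphi^*(w)=w\circ\varphi$. It acts on $V$ by $\varphi\cdot v=\varphi(v)$ and on $V_*$ by $\varphi\cdot w=-\varphi^*(w)$. For a Lie algebra automorphism $h\in\operatorname{Aut}(\mathfrak{gl}^M_\infty)$ (over $\mathbb{C}$) and a $\mathfrak{gl}^M_\infty$-module $M$, let $M^h$ denote the vector space $M$ with the new action $\varphi\cdot_{\mathrm{new}}m=h(\varphi)\cdot m$. Then for every $h\in\operatorname{Aut}(\mathfrak{gl}^M_\infty)$, the $\mathfrak{gl}^M_\infty$-module $V^h$ is isomorphic to $V$ or to $V_*$. -/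

import Mathlib

open Module

attribute [local instance] LieRing.ofAssociativeRing

/-- For a vector space `U` and a subspace `W` of the algebraic dual `U^*`, the Mackey Lie algebra
of all endomorphisms `φ` of `U` with `φ^*(W) ⊆ W`, a Lie subalgebra of `End(U)` with the
commutator bracket. -/
def mackeyLieAlgebra {K U : Type*} [Field K] [AddCommGroup U] [Module K U]
    (W : Submodule K (Dual K U)) : LieSubalgebra K (End K U) where
  carrier := {φ | ∀ w ∈ W, φ.dualMap w ∈ W}
  zero_mem' := fun w _ => by
    have h0 : (0 : End K U).dualMap w = 0 := by ext u; simp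
    rw [h0]; exact W.zero_mem
  add_mem' := fun {φ ψ} hφ hψ w hw => by
    have h0 : (φ + ψ).dualMap w = φ.dualMap w + ψ.dualMap w := by ext u; simp
    rw [h0]; exact W.add_mem (hφ w hw) (hψ w hw)
  smul_mem' := fun c φ hφ w hw => by
    have h0 : (c • φ).dualMap w = c • φ.dualMap w := by ext u; simp
    rw [h0]; exact W.smul_mem c (hφ w hw)
  lie_mem' := fun {φ ψ} hφ hψ w hw => by
    have h0 : ⁅φ, ψ⁆.dualMap w = ψ.dualMap (φ.dualMap w) - φ.dualMap (ψ.dualMap w) := by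
      ext u; simp [LieRing.of_associative_ring_bracket]
    rw [h0]; exact W.sub_mem (hψ _ (hφ w hw)) (hφ _ (hψ w hw))

/-- The subspace `W` of `U^*` as a module over the Mackey Lie algebra of `(U, W)`: a submodule of
the dual of the natural module `U`, so that `φ` acts on `W` by `-φ^*`. -/
def mackeyConatural {K U : Type*} [Field K] [AddCommGroup U] [Module K U]
    (W : Submodule K (Dual K U)) : LieSubmodule K (mackeyLieAlgebra W) (Dual K U) where
  __ := W
  lie_mem := fun {φ w} hw => by
    have h0 : ⁅φ, w⁆ = -((φ : End K U).dualMap w) := by ext u; simp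
    rw [h0]; exact W.neg_mem (φ.2 w hw)

/-- The span `V_*` in `V^*` of the functionals `e^i` dual to the basis `e` of `V`. -/
noncomputable def restrictedDual {V : Type*} [AddCommGroup V] [Module ℂ V] (e : Basis ℕ ℂ V) :
    Submodule ℂ (Dual ℂ V) :=
  Submodule.span ℂ (Set.range e.coord)

/-- The Lie algebra `𝔤𝔩^M_∞` of the pair `(V, V_*)`. -/
noncomputable abbrev glMInfty {V : Type*} [AddCommGroup V] [Module ℂ V] (e : Basis ℕ ℂ V) :
    LieSubalgebra ℂ (End ℂ V) :=
  mackeyLieAlgebra (restrictedDual e)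

/-- The space `V_*` as a `𝔤𝔩^M_∞`-module. -/
noncomputable abbrev conaturalModule {V : Type*} [AddCommGroup V] [Module ℂ V] (e : Basis ℕ ℂ V) :
    LieSubmodule ℂ (glMInfty e) (Dual ℂ V) :=
  mackeyConatural (restrictedDual e)

/-- The module `M^h`: the vector space `M` on which `x` acts as `h x` acts on `M`. -/
@[nolint unusedArguments]
def TwistedModule {K L : Type*} [CommRing K] [LieRing L] [LieAlgebra K L]
    (_h : L ≃ₗ⁅K⁆ L) (M : Type*) : Type _ := M

section TwistedModule

variable {K L M : Type*} [CommRing K] [LieRing L] [LieAlgebra K L] (h : L ≃ₗ⁅K⁆ L)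
  [AddCommGroup M] [Module K M] [LieRingModule L M] [LieModule K L M]

instance : AddCommGroup (TwistedModule h M) := inferInstanceAs (AddCommGroup M)

instance : Module K (TwistedModule h M) := inferInstanceAs (Module K M)

instance : LieRingModule L (TwistedModule h M) :=
  LieRingModule.compLieHom M (h : L →ₗ⁅K⁆ L)

instance : LieModule K L (TwistedModule h M) :=
  LieModule.compLieHom M (h : L →ₗ⁅K⁆ L)

end TwistedModule

/-! The natural module can be recognized inside a twist. Let `E` be the space of `w` in `V_*` with
`w (e 0) = 0`. The operators `e 0 ⊗ w`, `w ∈ E`, have square zero, so each such `X` is extremal: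
`[X, [X, Y]]` is always a multiple of `X`. Automorphisms preserve extremality, and extremal
noncentral elements have rank one (`exists_eq_smulRight_of_extremal`). So `h⁻¹` carries this family
to a linear space of operators of rank at most one, whose members share a range or a kernel
(`range_or_ker_of_rankOne`).

With a common range, the family acts on `V` twisted by `h⁻¹` as it does on the natural module; with
a common kernel, passing to transposes gives the same for `V_*`. `nonempty_equiv_of_range_rankOne`
then identifies the twist with `V`: the common line is spanned by some `m`, on which the annihilator
of `e 0` acts by a character. That annihilator is perfect by an Eilenberg swindle
(`stabilizer_induction`), so it kills `m`, and `x • m` depends only on `x (e 0)`. This defines the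
isomorphism from `V`. -/

section MackeyLieAlgebra

variable {V : Type*} [AddCommGroup V] [Module ℂ V] (e : Basis ℕ ℂ V)

theorem coord_mem_restrictedDual (i : ℕ) : e.coord i ∈ restrictedDual e :=
  Submodule.subset_span ⟨i, rfl⟩

theorem mem_glMInfty_of_coord {φ : End ℂ V}
    (hφ : ∀ j, e.coord j ∘ₗ φ ∈ restrictedDual e) : φ ∈ glMInfty e := by
  intro w hw
  have hle : restrictedDual e ≤ (restrictedDual e).comap φ.dualMap := by
    refine Submodule.span_le.2 ?_
    rintro _ ⟨j, rfl⟩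
    exact hφ j
  exact hle hw

theorem comp_mem_restrictedDual {φ : End ℂ V} (hφ : φ ∈ glMInfty e) {w : Dual ℂ V}
    (hw : w ∈ restrictedDual e) : w ∘ₗ φ ∈ restrictedDual e := hφ w hw

theorem mul_mem_glMInfty {φ ψ : End ℂ V} (hφ : φ ∈ glMInfty e) (hψ : ψ ∈ glMInfty e) :
    φ * ψ ∈ glMInfty e := fun w hw => hψ _ (hφ w hw)

/-! ### Partial permutations and the Eilenberg swindle -/

/-- The operator which sends `e i` to `e j` if `f i = some j`, and to `0` if `f i = none`. -/
noncomputable def partialPerm (f : ℕ ≃. ℕ) : End ℂ V :=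
  e.constr ℂ fun i => (f i).elim 0 e

@[simp]
theorem partialPerm_basis (f : ℕ ≃. ℕ) (i : ℕ) : partialPerm e f (e i) = (f i).elim 0 e := by
  simp [partialPerm]

theorem coord_comp_partialPerm (f : ℕ ≃. ℕ) (j : ℕ) :
    e.coord j ∘ₗ partialPerm e f = (f.symm j).elim 0 e.coord := by
  refine e.ext fun i => ?_
  have key := f.eq_some_iff (a := i) (b := j)
  rcases h1 : f i with _ | k <;> rcases h2 : f.symm j with _ | l <;>
    simp [h1, h2, Finsupp.single_apply] at key ⊢ <;> grind

theorem partialPerm_mem (f : ℕ ≃. ℕ) : partialPerm e f ∈ glMInfty e := by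
  refine mem_glMInfty_of_coord e fun j => ?_
  rw [coord_comp_partialPerm]
  rcases f.symm j with _ | l
  · exact Submodule.zero_mem _
  · exact coord_mem_restrictedDual e l

/-- `n ↦ 2 n` on the positive integers. -/
def evenShift : ℕ ≃. ℕ where
  toFun n := if n = 0 then none else some (2 * n)
  invFun n := if n = 0 ∨ n % 2 = 1 then none else some (n / 2)
  inv a b := by split_ifs <;> simp <;> omega

/-- `n ↦ 2 n - 1` on the positive integers. -/
def oddShift : ℕ ≃. ℕ where
  toFun n := if n = 0 then none else some (2 * n - 1)
  invFun n := if n % 2 = 0 then none else some ((n + 1) / 2)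
  inv a b := by split_ifs <;> simp <;> omega

/-- The identity on the positive integers. -/
def positivePart : ℕ ≃. ℕ := PEquiv.ofSet {n | n ≠ 0}

theorem evenShift_apply (n : ℕ) : evenShift n = if n = 0 then none else some (2 * n) := rfl

theorem evenShift_symm_apply (n : ℕ) :
    evenShift.symm n = if n = 0 ∨ n % 2 = 1 then none else some (n / 2) := rfl

theorem oddShift_apply (n : ℕ) : oddShift n = if n = 0 then none else some (2 * n - 1) := rfl

theorem oddShift_symm_apply (n : ℕ) :
    oddShift.symm n = if n % 2 = 0 then none else some ((n + 1) / 2) := rfl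

theorem positivePart_apply (n : ℕ) : positivePart n = if n = 0 then none else some n := by
  by_cases h : n = 0 <;> simp [positivePart, PEquiv.ofSet, h]

theorem evenShift_symm_mul :
    partialPerm e evenShift.symm * partialPerm e evenShift = partialPerm e positivePart := by
  refine e.ext fun i => ?_
  by_cases h : i = 0 <;> simp [evenShift_apply, evenShift_symm_apply, positivePart_apply, h]

theorem oddShift_symm_mul :
    partialPerm e oddShift.symm * partialPerm e oddShift = partialPerm e positivePart := by
  refine e.ext fun i => ?_
  by_cases h : i = 0
  · simp [oddShift_apply, positivePart_apply, h]
  · have h1 : (2 * i - 1) % 2 ≠ 0 := by omega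
    have h2 : (2 * i - 1 + 1) / 2 = i := by omega
    simp [oddShift_apply, oddShift_symm_apply, positivePart_apply, h, h1, h2]

/-- The columns of the solution `X` of `X = d + S X S^*`, where `S` is the operator of
`evenShift` and `d` has nonzero columns at odd indices only. -/
noncomputable def swindleColumn (d : End ℂ V) : ℕ → V
  | n => if h : n = 0 ∨ n % 2 = 1 then d (e n)
    else partialPerm e evenShift (swindleColumn d (n / 2))
termination_by n => n
decreasing_by omega

/-- The infinite sum `d + S d S^* + S^2 d (S^*)^2 + ⋯`, where `S` is the operator of
`evenShift`. -/
noncomputable def swindle (d : End ℂ V) : End ℂ V := e.constr ℂ (swindleColumn e d)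

theorem swindle_eq {d : End ℂ V} (hd : ∀ n, n % 2 = 0 → d (e n) = 0) :
    swindle e d = d + partialPerm e evenShift * swindle e d * partialPerm e evenShift.symm := by
  refine e.ext fun n => ?_
  have h0 : swindle e d (e n) = swindleColumn e d n := by simp [swindle]
  rw [h0, swindleColumn]
  by_cases h : n = 0 ∨ n % 2 = 1
  · simp [h, evenShift_symm_apply]
  · simp [h, evenShift_symm_apply, hd n (by omega), swindle]

/-- Since `e^j ∘ S` is `e^(j/2)` or `0`, the recursion expresses row `j` through row `j / 2`, and it
stops at odd `j` and at `0`. -/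
theorem swindle_mem {d : End ℂ V} (hd : ∀ n, n % 2 = 0 → d (e n) = 0) (hL : d ∈ glMInfty e) :
    swindle e d ∈ glMInfty e := by
  refine mem_glMInfty_of_coord e fun j => ?_
  induction j using Nat.strong_induction_on with
  | _ j ih =>
    have h1 : e.coord j ∘ₗ swindle e d = e.coord j ∘ₗ d +
        ((e.coord j ∘ₗ partialPerm e evenShift) ∘ₗ swindle e d) ∘ₗ
          partialPerm e evenShift.symm := by
      conv_lhs => rw [swindle_eq e hd]
      exact LinearMap.ext fun v => by simp
    rw [h1, coord_comp_partialPerm, evenShift_symm_apply]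
    refine Submodule.add_mem _ (comp_mem_restrictedDual e hL (coord_mem_restrictedDual e j)) ?_
    split_ifs with h
    · simp
    · exact comp_mem_restrictedDual e (partialPerm_mem e _) (ih (j / 2) (by omega))

/-- An additive property of endomorphisms that holds for the commutators of the stabilizer of
`e 0` in `𝔤𝔩^M_∞` holds on this whole stabilizer. -/
theorem stabilizer_induction {P : End ℂ V → Prop}
    (hadd : ∀ x ∈ glMInfty e, ∀ y ∈ glMInfty e, P x → P y → P (x + y))
    (hcomm : ∀ x ∈ glMInfty e, ∀ y ∈ glMInfty e, x (e 0) = 0 → y (e 0) = 0 →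
      P (x * y - y * x))
    {x : End ℂ V} (hx : x ∈ glMInfty e) (hx0 : x (e 0) = 0) : P x := by
  set I := partialPerm e positivePart with hI
  set S := partialPerm e evenShift with hS
  set S' := partialPerm e evenShift.symm with hS'
  set U := partialPerm e oddShift with hU
  set U' := partialPerm e oddShift.symm with hU'
  have hIL : I ∈ glMInfty e := partialPerm_mem e _
  have hSL : S ∈ glMInfty e := partialPerm_mem e _
  have hSL' : S' ∈ glMInfty e := partialPerm_mem e _
  have hUL : U ∈ glMInfty e := partialPerm_mem e _
  have hUL' : U' ∈ glMInfty e := partialPerm_mem e _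
  have hI0 : I (e 0) = 0 := by simp [hI, positivePart_apply]
  have hS0 : S (e 0) = 0 := by simp [hS, evenShift_apply]
  have hS0' : S' (e 0) = 0 := by simp [hS', evenShift_symm_apply]
  have hU0 : U (e 0) = 0 := by simp [hU, oddShift_apply]
  have hU0' : U' (e 0) = 0 := by simp [hU', oddShift_symm_apply]
  have hII : I * I = I := by
    refine e.ext fun i => ?_
    by_cases h : i = 0 <;> simp [hI, positivePart_apply, h]
  have hIe : ∀ i, i ≠ 0 → I (e i) = e i := fun i h => by simp [hI, positivePart_apply, h]
  have hxI : x * I = x := by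
    refine e.ext fun i => ?_
    by_cases h : i = 0
    · subst h; simp [hI0, hx0]
    · simp [hIe i h]
  set c := I * x with hc
  have hcL : c ∈ glMInfty e := mul_mem_glMInfty e hIL hx
  have hcI : c * I = c := by rw [hc, mul_assoc, hxI]
  set d := U * c * U' with hd
  have hdL : d ∈ glMInfty e := mul_mem_glMInfty e (mul_mem_glMInfty e hUL hcL) hUL'
  have hdn : ∀ n, n % 2 = 0 → d (e n) = 0 := fun n hn => by
    simp [hd, hU', oddShift_symm_apply, hn]
  set X := swindle e d with hX
  have hXL : X ∈ glMInfty e := swindle_mem e hdn hdL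
  have hXe : X = d + S * X * S' := swindle_eq e hdn
  have hIX : I * X = X := by
    have h1 : I * U = U := by
      refine e.ext fun i => ?_
      by_cases h : i = 0
      · subst h; simp [hU0]
      · simp [hU, oddShift_apply, h, hIe (2 * i - 1) (by omega)]
    have h2 : I * S = S := by
      refine e.ext fun i => ?_
      by_cases h : i = 0
      · subst h; simp [hS0]
      · simp [hS, evenShift_apply, h, hIe (2 * i) (by omega)]
    rw [hXe, hd]
    simp only [mul_add, ← mul_assoc, h1, h2]
  have hX0 : X (e 0) = 0 := by
    rw [hXe]; simp [hS0', hdn 0 rfl]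
  -- Three commutators: `[x, I] = x - c`, `[c U', U] = c - d`, and `[S', S X] = X - S X S' = d`.
  -- Every factor kills `e 0`.
  have e1 : x = (x * I - I * x) + ((c * U' * U - U * (c * U')) + (S' * (S * X) - S * X * S')) := by
    have h1 : S' * (S * X) = X := by rw [← mul_assoc, evenShift_symm_mul, hIX]
    have h2 : c * U' * U = c := by rw [mul_assoc, oddShift_symm_mul, hcI]
    have h3 : S * X * S' = X - d := by rw [eq_sub_iff_add_eq, add_comm, ← hXe]
    rw [h1, h2, h3, hxI, ← mul_assoc U, ← hd, ← hc]
    abel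
  have hsub : ∀ a ∈ glMInfty e, ∀ b ∈ glMInfty e, a * b - b * a ∈ glMInfty e :=
    fun a ha b hb => sub_mem (mul_mem_glMInfty e ha hb) (mul_mem_glMInfty e hb ha)
  have hcU : c * U' ∈ glMInfty e := mul_mem_glMInfty e hcL hUL'
  have hSX : S * X ∈ glMInfty e := mul_mem_glMInfty e hSL hXL
  rw [e1]
  refine hadd _ (hsub _ hx _ hIL) _ (add_mem (hsub _ hcU _ hUL) (hsub _ hSL' _ hSX))
    (hcomm _ hx _ hIL hx0 hI0) (hadd _ (hsub _ hcU _ hUL) _ (hsub _ hSL' _ hSX)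
      (hcomm _ hcU _ hUL (by simp [hU0']) hU0) (hcomm _ hSL' _ hSX hS0' (by simp [hX0])))

end MackeyLieAlgebra

/-! ### Operators of rank one: linear families and extremal elements -/

section RankOne

/-- Two rank one operators with different ranges and different kernels have a sum of rank two. If
some `R w₁` does not share the kernel of `R w₀`, it shares its range; an operator with another range
would need the kernels of both. -/
theorem range_or_ker_of_rankOne {K E V : Type*} [Field K] [AddCommGroup E]
    [AddCommGroup V] [Module K V] (R : E →+ End K V)
    (hR : ∀ w, ∃ (s : V) (ω : Dual K V), R w = ω.smulRight s) {w₀ : E} (h0 : R w₀ ≠ 0) :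
    (∃ m : V, ∀ w z, ∃ c : K, R w z = c • m) ∨
      (∃ ω : Dual K V, ∀ w, ∃ s : V, R w = ω.smulRight s) := by
  obtain ⟨s₀, ω₀, hs₀⟩ := hR w₀
  have hs₀0 : s₀ ≠ 0 := by rintro rfl; exact h0 (by rw [hs₀]; ext; simp)
  have hω₀0 : ω₀ ≠ 0 := by rintro rfl; exact h0 (by rw [hs₀]; ext; simp)
  -- Two operators of rank one whose sum has rank at most one share their range or kernel
  have key : ∀ (s t r : V) (σ τ ρ : Dual K V),
      σ.smulRight s + τ.smulRight t = ρ.smulRight r → s ≠ 0 → σ ≠ 0 →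
      (∃ c : K, t = c • s) ∨ ∃ c : K, τ = c • σ := by
    intro s t r σ τ ρ h hs hσ
    by_cases hker : ∀ z, σ z = 0 → τ z = 0
    · right
      obtain ⟨z, hz⟩ : ∃ z, σ z ≠ 0 := by
        by_contra! hall; exact hσ (LinearMap.ext hall)
      refine ⟨τ z / σ z, LinearMap.ext fun u => ?_⟩
      have := hker (u - (σ u / σ z) • z) (by simp [hz])
      simp only [map_sub, map_smul, smul_eq_mul, sub_eq_zero] at this
      rw [this, LinearMap.smul_apply, smul_eq_mul]; ring
    · left
      push Not at hker
      obtain ⟨z, hz, hτ⟩ := hker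
      have h1 : ∀ u, σ u • s + τ u • t = ρ u • r := fun u => LinearMap.congr_fun h u
      have hz1 : τ z • t = ρ z • r := by simpa [hz] using h1 z
      obtain ⟨y, hy⟩ : ∃ z, σ z ≠ 0 := by
        by_contra! hall; exact hσ (LinearMap.ext hall)
      by_cases hρ : ρ z = 0
      · refine ⟨0, ?_⟩
        rw [hρ, zero_smul, smul_eq_zero] at hz1
        simpa using hz1.resolve_left hτ
      · have hr : r = (τ z / ρ z) • t := by
          rw [div_eq_inv_mul, mul_smul, hz1, smul_smul, inv_mul_cancel₀ hρ, one_smul]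
        have hy1 := h1 y
        rw [hr, smul_smul, ← eq_sub_iff_add_eq, ← sub_smul] at hy1
        set a := ρ y * (τ z / ρ z) - τ y with ha
        have ha0 : a ≠ 0 := by
          intro h0; rw [h0, zero_smul, smul_eq_zero] at hy1
          exact hy1.elim hy hs
        refine ⟨σ y / a, ?_⟩
        rw [div_eq_inv_mul, mul_smul, hy1, smul_smul, inv_mul_cancel₀ ha0, one_smul]
  by_cases hA : ∀ w, ∃ s : V, R w = ω₀.smulRight s
  · exact Or.inr ⟨ω₀, hA⟩
  left
  push Not at hA
  obtain ⟨w₁, hw₁⟩ := hA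
  obtain ⟨s₁, ω₁, hs₁⟩ := hR w₁
  have hpar : ∀ w s ω, R w = ω.smulRight s → (∃ c : K, s = c • s₀) ∨ ∃ c : K, ω = c • ω₀ := by
    intro w s ω hw
    obtain ⟨r, ρ, h⟩ := hR (w₀ + w)
    rw [map_add, hs₀, hw] at h
    exact key _ _ _ _ _ _ h hs₀0 hω₀0
  have hnot : ¬ ∃ c : K, ω₁ = c • ω₀ := by
    rintro ⟨c, rfl⟩
    exact hw₁ (c • s₁) (by rw [hs₁]; ext; simp [smul_smul, mul_comm])
  obtain ⟨c₁, rfl⟩ := (hpar _ _ _ hs₁).resolve_right hnot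
  have hω₁ : ω₁ ≠ 0 := by rintro rfl; exact hnot ⟨0, by simp⟩
  have hc₁ : c₁ ≠ 0 := by
    rintro rfl; exact hw₁ 0 (by rw [hs₁]; ext; simp)
  refine ⟨s₀, fun w z => ?_⟩
  obtain ⟨s, ω, hs⟩ := hR w
  by_cases hpw : ∃ c : K, s = c • s₀
  · obtain ⟨c, rfl⟩ := hpw
    exact ⟨ω z * c, by simp [hs, smul_smul]⟩
  obtain ⟨c, rfl⟩ := (hpar _ _ _ hs).resolve_left hpw
  obtain ⟨r, ρ, h⟩ := hR (w₁ + w)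
  rw [map_add, hs₁, hs] at h
  rcases key _ _ _ _ _ _ h (smul_ne_zero hc₁ hs₀0) hω₁ with ⟨d, hd⟩ | ⟨d, hd⟩
  · exact absurd ⟨d * c₁, by rw [hd, smul_smul]⟩ hpw
  · by_cases hc : c = 0
    · exact ⟨0, by simp [hs, hc]⟩
    · exfalso
      have hd0 : d ≠ 0 := by
        rintro rfl
        rw [zero_smul, smul_eq_zero] at hd
        exact hd.elim hc hω₀0
      exact hnot ⟨d⁻¹ * c, by rw [mul_smul, hd, smul_smul, inv_mul_cancel₀ hd0, one_smul]⟩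

variable {V : Type*} [AddCommGroup V] [Module ℂ V] (e : Basis ℕ ℂ V)

theorem smulRight_mem_glMInfty (v : V) {w : Dual ℂ V} (hw : w ∈ restrictedDual e) :
    w.smulRight v ∈ glMInfty e := by
  intro η _
  have h0 : (w.smulRight v).dualMap η = η v • w := by ext; simp [mul_comm]
  rw [h0]
  exact Submodule.smul_mem _ _ hw

theorem exists_restrictedDual_ne_zero {v : V} (hv : v ≠ 0) :
    ∃ w ∈ restrictedDual e, w v ≠ 0 := by
  by_contra! h
  exact hv (e.ext_elem fun i => by simpa using h _ (coord_mem_restrictedDual e i))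

theorem exists_restrictedDual_of_ne_smul {u v : V} (hu : u ≠ 0) (hv : ∀ c : ℂ, v ≠ c • u) :
    ∃ w ∈ restrictedDual e, w u = 0 ∧ w v ≠ 0 := by
  obtain ⟨α, hα, hαu⟩ := exists_restrictedDual_ne_zero e hu
  obtain ⟨β, hβ, hβv⟩ := exists_restrictedDual_ne_zero e (sub_ne_zero.2 (hv (α v / α u)))
  refine ⟨β - (β u / α u) • α, Submodule.sub_mem _ hβ (Submodule.smul_mem _ _ hα), ?_, ?_⟩
  · simp [hαu]
  · intro h
    apply hβv
    simp only [LinearMap.sub_apply, LinearMap.smul_apply, smul_eq_mul] at h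
    simp only [map_sub, map_smul, smul_eq_mul]
    linear_combination h

theorem exists_ne_smul_of_not_commute {X Y : End ℂ V} (hXY : X * Y ≠ Y * X) :
    ∃ u, u ≠ 0 ∧ ∀ c : ℂ, X u ≠ c • u := by
  by_contra! h
  obtain ⟨a, ha⟩ := X.exists_eq_smul_id_of_forall_notLinearIndependent fun u => by
    intro hli
    obtain ⟨c, hc⟩ := h u (hli.ne_zero 0)
    have := LinearIndependent.pair_iff.1 hli c (-1) (by simp [hc])
    simp at this
  exact hXY (by rw [ha]; ext; simp)

/-- A noncentral element `X` of `𝔤𝔩^M_∞` such that `[X, [X, Y]]` is a multiple of `X` for all `Y`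
has rank one. -/
theorem exists_eq_smulRight_of_extremal {X : End ℂ V} {u : V} (hu0 : u ≠ 0)
    (hu : ∀ c : ℂ, X u ≠ c • u)
    (hX : ∀ Y ∈ glMInfty e, ∃ c : ℂ, X * (X * Y - Y * X) - (X * Y - Y * X) * X = c • X) :
    ∃ (s : V) (ω : Dual ℂ V), X = ω.smulRight s := by
  have hr : ∀ p : V, ∀ w ∈ restrictedDual e, ∃ g : ℂ, ∀ z,
      w z • X (X p) - (2 * w (X z)) • X p + w (X (X z)) • p = g • X z := by
    intro p w hw
    obtain ⟨g, hg⟩ := hX _ (smulRight_mem_glMInfty e p hw)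
    refine ⟨g, fun z => ?_⟩
    have := LinearMap.congr_fun hg z
    simp only [LinearMap.sub_apply, Module.End.mul_apply, LinearMap.smulRight_apply, map_sub,
      map_smul, LinearMap.smul_apply] at this
    rw [← this]
    module
  have fin : ∀ (g : ℂ) (s : V) (ω : Dual ℂ V), g ≠ 0 → (∀ z, ω z • s = g • X z) →
      ∃ (s : V) (ω : Dual ℂ V), X = ω.smulRight s := by
    intro g s ω hg h
    refine ⟨g⁻¹ • s, ω, LinearMap.ext fun z => ?_⟩
    rw [LinearMap.smulRight_apply, smul_comm, h, smul_smul, inv_mul_cancel₀ hg, one_smul]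
  by_contra hcon
  -- Taking `Y = u ⊗ w` with `w u = 0` and `w (X u) ≠ 0` forces `g ≠ 0`, so the range of `X` lies in
  -- the span of `u`, `X u`, `X (X u)`; a coordinate outside their supports kills it.
  obtain ⟨η, hη, hηX⟩ : ∃ η ∈ restrictedDual e, η ≠ 0 ∧ ∀ z, η (X z) = 0 := by
    obtain ⟨w, hw, hwu, hwX⟩ := exists_restrictedDual_of_ne_smul e hu0 hu
    obtain ⟨g, hg⟩ := hr u w hw
    have hg0 : g ≠ 0 := by
      rintro rfl
      have := hg u
      rw [hwu, zero_smul, zero_smul, zero_sub, neg_add_eq_zero] at this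
      have h2 : 2 * w (X u) ≠ 0 := mul_ne_zero two_ne_zero hwX
      refine hu ((2 * w (X u))⁻¹ * w (X (X u))) ?_
      rw [mul_smul, ← this, smul_smul, inv_mul_cancel₀ h2, one_smul]
    obtain ⟨N, hN⟩ := ((e.repr u).support ∪ (e.repr (X u)).support ∪
      (e.repr (X (X u))).support).exists_notMem
    simp only [Finset.mem_union, Finsupp.mem_support_iff, not_or, not_not] at hN
    refine ⟨e.coord N, coord_mem_restrictedDual e N, fun h => ?_, fun z => ?_⟩
    · simpa using LinearMap.congr_fun h (e N)
    · have := congrArg (e.coord N) (hg z)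
      simpa [hN, hg0] using this
  -- For `Y = p ⊗ η` only `X (X p) ⊗ η` survives in `[X, [X, Y]]`, so either it vanishes or `X` is a
  -- multiple of it.
  have hXX : ∀ p, X (X p) = 0 := by
    intro p
    obtain ⟨g, hg⟩ := hr p η hη
    have hg' : ∀ z, η z • X (X p) = g • X z := fun z => by simpa [hηX.2] using hg z
    have hg0 : g = 0 := by
      by_contra h0
      exact hcon (fin g _ η h0 hg')
    obtain ⟨z, hz⟩ : ∃ z, η z ≠ 0 := by
      by_contra! hall; exact hηX.1 (LinearMap.ext hall)
    simpa [hg0, hz] using hg' z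
  have hXu : X u ≠ 0 := fun h => hu 0 (by simp [h])
  obtain ⟨w, hw, hwX⟩ := exists_restrictedDual_ne_zero e hXu
  obtain ⟨g, hg⟩ := hr u w hw
  have hg' : ∀ z, (-(2 * w (X z))) • X u = g • X z := fun z => by simpa [hXX] using hg z
  refine hcon (fin g (X u) ((-2 : ℂ) • (w ∘ₗ X)) ?_ fun z => ?_)
  · rintro rfl
    simpa [hwX, hXu] using hg' u
  · rw [← hg']; simp

end RankOne

/-! ### Recognition of the natural module -/

section Recognition

variable {V : Type*} [AddCommGroup V] [Module ℂ V] (e : Basis ℕ ℂ V)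

/-- The rank one operator `v ⊗ w`, linear in `w`. -/
noncomputable def rankOne (v : V) : restrictedDual e →ₗ[ℂ] glMInfty e where
  toFun w := ⟨(w : Dual ℂ V).smulRight v, smulRight_mem_glMInfty e v w.2⟩
  map_add' w w' := Subtype.ext (by ext; simp [add_smul])
  map_smul' c w := Subtype.ext (by ext; simp [mul_smul])

@[simp]
theorem rankOne_apply (v : V) (w : restrictedDual e) (u : V) :
    (rankOne e v w : End ℂ V) u = (w : Dual ℂ V) u • v := rfl

theorem glMInfty_lie_apply (x y : glMInfty e) (v : V) :
    ((⁅x, y⁆ : glMInfty e) : End ℂ V) v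
      = (x : End ℂ V) ((y : End ℂ V) v) - (y : End ℂ V) ((x : End ℂ V) v) := rfl

theorem glMInfty_ext {x y : glMInfty e} (h : ∀ v, (x : End ℂ V) v = (y : End ℂ V) v) : x = y :=
  Subtype.ext (LinearMap.ext h)

/-- The functional `w ∘ x` for `w` in `V_*` and `x` in `𝔤𝔩^M_∞`. -/
noncomputable def restrictedComp (w : restrictedDual e) (x : glMInfty e) : restrictedDual e :=
  ⟨(w : Dual ℂ V) ∘ₗ (x : End ℂ V), comp_mem_restrictedDual e x.2 w.2⟩

@[simp]
theorem restrictedComp_apply (w : restrictedDual e) (x : glMInfty e) (v : V) :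
    (restrictedComp e w x : Dual ℂ V) v = (w : Dual ℂ V) ((x : End ℂ V) v) := rfl

/-- The coordinate functional `e^i` as an element of `V_*`. -/
noncomputable def restrictedCoord (i : ℕ) : restrictedDual e :=
  ⟨e.coord i, coord_mem_restrictedDual e i⟩

@[simp]
theorem restrictedCoord_apply (i : ℕ) (v : V) :
    (restrictedCoord e i : Dual ℂ V) v = e.repr v i := rfl

variable {M : Type*} [AddCommGroup M] [Module ℂ M] [LieRingModule (glMInfty e) M]
  [LieModule ℂ (glMInfty e) M]

/-- A module over `𝔤𝔩^M_∞` generated by each nonzero vector, on which the operators `e 0 ⊗ w`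
with `w (e 0) = 0` have their ranges in a common line and do not all vanish, is isomorphic to
the natural module. -/
theorem nonempty_equiv_of_range_rankOne
    (htrans : ∀ m : M, m ≠ 0 → ∀ u, ∃ x : glMInfty e, ⁅x, m⁆ = u) (m : M)
    (hm : ∀ w : restrictedDual e, (w : Dual ℂ V) (e 0) = 0 → ∀ z : M,
      ∃ c : ℂ, ⁅rankOne e (e 0) w, z⁆ = c • m)
    {w₀ : restrictedDual e} (hw₀ : (w₀ : Dual ℂ V) (e 0) = 0) {z₀ : M}
    (hz₀ : ⁅rankOne e (e 0) w₀, z₀⁆ ≠ 0) :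
    Nonempty (V ≃ₗ⁅ℂ, glMInfty e⁆ M) := by
  have hmz : ∃ z, ⁅rankOne e (e 0) w₀, z⁆ = m := by
    obtain ⟨c, hc⟩ := hm w₀ hw₀ z₀
    have hc0 : c ≠ 0 := by rintro rfl; exact hz₀ (by rw [hc, zero_smul])
    exact ⟨c⁻¹ • z₀, by rw [lie_smul, hc, smul_smul, inv_mul_cancel₀ hc0, one_smul]⟩
  have hm0 : m ≠ 0 := by
    rintro rfl
    obtain ⟨c, hc⟩ := hm w₀ hw₀ z₀
    exact hz₀ (by rw [hc, smul_zero])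
  have hlie : ∀ (x : glMInfty e) (v : V) (w : restrictedDual e),
      ⁅x, rankOne e v w⁆ = rankOne e ((x : End ℂ V) v) w - rankOne e v (restrictedComp e w x) := by
    intro x v w
    exact glMInfty_ext e fun u => by simp
  -- Such an `x` normalizes the family: `[x, e 0 ⊗ w₀] = e 0 ⊗ (a w₀ - w₀ ∘ x)`, so it preserves the
  -- common line.
  have hline : ∀ (x : glMInfty e) (a : ℂ), (x : End ℂ V) (e 0) = a • e 0 →
      ∃ c : ℂ, ⁅x, m⁆ = c • m := by
    intro x a hx
    obtain ⟨z, hz⟩ := hmz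
    obtain ⟨c, hc⟩ := hm w₀ hw₀ ⁅x, z⁆
    obtain ⟨d, hd⟩ := hm (a • w₀ - restrictedComp e w₀ x) (by simp [hx, hw₀]) z
    refine ⟨d + c, ?_⟩
    have h1 : ⁅x, rankOne e (e 0) w₀⁆ =
        rankOne e (e 0) (a • w₀ - restrictedComp e w₀ x) := by
      exact glMInfty_ext e fun u => by simp [hx, smul_smul, mul_comm]
    rw [add_smul, ← hc, ← hd, ← h1, ← leibniz_lie, hz]
  have hA : ∀ x : glMInfty e, (x : End ℂ V) (e 0) = 0 → ⁅x, m⁆ = 0 := by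
    intro x hx
    refine stabilizer_induction e (P := fun X => ∀ hX : X ∈ glMInfty e,
      ⁅(⟨X, hX⟩ : glMInfty e), m⁆ = 0) ?_ ?_ x.2 hx x.2
    · intro X hX Y hY h1 h2 hXY
      have h3 : (⟨X + Y, hXY⟩ : glMInfty e) = ⟨X, hX⟩ + ⟨Y, hY⟩ := rfl
      rw [h3, add_lie, h1, h2, add_zero]
    · intro X hX Y hY h1 h2 hXY
      have h3 : (⟨X * Y - Y * X, hXY⟩ : glMInfty e) = ⁅(⟨X, hX⟩ : glMInfty e), ⟨Y, hY⟩⁆ := rfl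
      obtain ⟨a, ha⟩ := hline ⟨X, hX⟩ 0 (by simpa using h1)
      obtain ⟨b, hb⟩ := hline ⟨Y, hY⟩ 0 (by simpa using h2)
      rw [h3, lie_lie, ha, hb, lie_smul, lie_smul, ha, hb, smul_comm, sub_self]
  let f : V →ₗ[ℂ] M :=
    { toFun := fun v => ⁅rankOne e v (restrictedCoord e 0), m⁆
      map_add' := fun u v => by
        rw [← add_lie]; congr 1; exact glMInfty_ext e fun _ => by simp
      map_smul' := fun c v => by
        rw [RingHom.id_apply, ← smul_lie]; congr 1
        exact glMInfty_ext e fun _ => by simp [smul_smul, mul_comm] }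
  have hf : ∀ v, f v = ⁅rankOne e v (restrictedCoord e 0), m⁆ := fun _ => rfl
  have hy : ∀ x : glMInfty e, ⁅x, m⁆ = f ((x : End ℂ V) (e 0)) := by
    intro x
    rw [hf, ← sub_eq_zero, ← sub_lie]
    exact hA _ (by simp)
  have hsurj : Function.Surjective f := fun u => by
    obtain ⟨x, hx⟩ := htrans m hm0 u
    exact ⟨_, (hy x).symm.trans hx⟩
  have hlm : ∀ x y : glMInfty e, ⁅x, ⁅y, m⁆⁆ =
      f ((x : End ℂ V) ((y : End ℂ V) (e 0)) - (y : End ℂ V) ((x : End ℂ V) (e 0))) +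
        ⁅y, ⁅x, m⁆⁆ := by
    intro x y
    rw [leibniz_lie, hy ⁅x, y⁆, glMInfty_lie_apply]
  obtain ⟨t, ht⟩ : ∃ t : ℂ, f (e 0) = t • m :=
    hline (rankOne e (e 0) (restrictedCoord e 0)) 1 (by simp)
  have hrf : ∀ (u v : V) (w : restrictedDual e), (w : Dual ℂ V) (e 0) = 0 →
      ⁅rankOne e u w, f v⁆ = (w : Dual ℂ V) v • f u := by
    intro u v w hw
    rw [hf v, hlm, hA (rankOne e u w) (by simp [hw]), lie_zero, add_zero]
    simp [hw]
  have ht0 : t ≠ 0 := by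
    rintro rfl
    obtain ⟨v, rfl⟩ := hsurj z₀
    exact hz₀ (by rw [hrf _ _ _ hw₀, ht, zero_smul, smul_zero])
  -- An `sl₂` computation with `E = e 0 ⊗ e^1` and `F = e 1 ⊗ e^0`: `E F F m = (2 t - 2) F m` lies
  -- in the line of `m`. If `t ≠ 1`, so does `F m`; but `E m = 0` and `E F m = t m ≠ 0`.
  have ht1 : t = 1 := by
    obtain ⟨c, hc⟩ := hm (restrictedCoord e 1) (by simp)
      ⁅rankOne e (e 1) (restrictedCoord e 0), f (e 1)⁆
    have hEF : ∀ v, (((⁅rankOne e (e 0) (restrictedCoord e 1),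
        rankOne e (e 1) (restrictedCoord e 0)⁆ : glMInfty e) : End ℂ V)) v =
          e.repr v 0 • e 0 - e.repr v 1 • e 1 := by
      intro v; simp
    have hH : ⁅⁅rankOne e (e 0) (restrictedCoord e 1), rankOne e (e 1) (restrictedCoord e 0)⁆, m⁆
        = t • m := by
      rw [hy, hEF, ← ht]; simp
    rw [leibniz_lie, hrf _ _ _ (by simp), hf (e 1), hlm, hH, hEF, ht, lie_smul, lie_smul,
      lie_smul, ← hf] at hc
    have h2 : (2 * t - 2) • f (e 1) = c • m := by
      rw [← hc]
      simp
      module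
    by_contra h1
    have h3 : (2 * t - 2) ≠ 0 := by
      intro h; apply h1; linear_combination h / 2
    have h4 := congrArg (fun z => ⁅rankOne e (e 0) (restrictedCoord e 1), z⁆) h2
    simp only [lie_smul] at h4
    rw [hrf _ _ _ (by simp), hA (rankOne e (e 0) (restrictedCoord e 1)) (by simp), ht] at h4
    simp [h3, ht0, hm0] at h4
  subst ht1
  rw [one_smul] at ht
  have hrf' : ∀ (v : V) (w : restrictedDual e),
      ⁅rankOne e (e 0) w, f v⁆ = (w : Dual ℂ V) v • m := by
    intro v w
    rw [hf v, hlm, hy (rankOne e (e 0) w)]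
    simp [ht, ← hf]
  have hinj : Function.Injective f := by
    rw [injective_iff_map_eq_zero]
    intro v hv
    by_contra hv0
    obtain ⟨w, hw, hwv⟩ := exists_restrictedDual_ne_zero e hv0
    have := hrf' v ⟨w, hw⟩
    rw [hv, lie_zero, eq_comm, smul_eq_zero] at this
    exact this.elim hwv hm0
  -- The defect of equivariance is killed by every `e 0 ⊗ w` with `w (e 0) = 0`, so it lies in the
  -- line of `f (e 0) = m`.
  have hδ : ∀ (x : glMInfty e) (v : V), ∃ a : ℂ, ⁅x, f v⁆ = f ((x : End ℂ V) v) + a • m := by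
    intro x v
    obtain ⟨u, hu⟩ := hsurj (⁅x, f v⁆ - f ((x : End ℂ V) v))
    suffices h : ∃ a : ℂ, u = a • e 0 by
      obtain ⟨a, rfl⟩ := h
      exact ⟨a, by rw [← ht, ← map_smul, hu]; abel⟩
    by_contra! hcon
    obtain ⟨w, hw, hw0, hwu⟩ := exists_restrictedDual_of_ne_smul e (e.ne_zero 0) hcon
    have h1 := hrf' u ⟨w, hw⟩
    rw [hu, lie_sub, hrf', leibniz_lie, ← lie_skew, hlie, neg_lie, sub_lie,
      hrf _ _ _ hw0, hrf', hrf' v, lie_smul, hy] at h1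
    simp only [restrictedComp_apply] at h1
    have h2 : (w u) • m = 0 := by
      rw [← h1]; abel
    exact (smul_eq_zero.1 h2).elim hwu hm0
  have hequi : ∀ (x : glMInfty e) (v : V), f ((x : End ℂ V) v) = ⁅x, f v⁆ := by
    intro x v
    obtain ⟨a, ha⟩ := hδ x v
    -- Expanding `[x, y] • f v` for `y = e N ⊗ e^0` shows `b x (e 0) - a e N ∈ ℂ e 0`; with `N`
    -- outside the support of `x (e 0)` and `N ≠ 0`, the coordinate at `N` gives `a = 0`.
    obtain ⟨N, hN⟩ := ((e.repr ((x : End ℂ V) (e 0))).support ∪ {0}).exists_notMem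
    simp only [Finset.mem_union, Finsupp.mem_support_iff, not_or, not_not,
      Finset.mem_singleton] at hN
    set y : glMInfty e := rankOne e (e N) (restrictedCoord e 0) with hydef
    obtain ⟨b, hb⟩ := hδ y v
    obtain ⟨c₁, hc₁⟩ := hδ ⁅x, y⁆ v
    obtain ⟨c₂, hc₂⟩ := hδ x ((y : End ℂ V) v)
    obtain ⟨c₃, hc₃⟩ := hδ y ((x : End ℂ V) v)
    rw [lie_lie, ha, hb, lie_add, lie_add, hc₂, hc₃, lie_smul, lie_smul, hy x, hy y,
      glMInfty_lie_apply, map_sub] at hc₁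
    have h1 : f (b • (x : End ℂ V) (e 0) - a • (y : End ℂ V) (e 0)) =
        f ((c₁ - c₂ + c₃) • e 0) := by
      simp only [map_sub, map_smul, ht]
      linear_combination (norm := module) hc₁
    have h2 := congrArg (fun v => e.repr v N) (hinj h1)
    have hN2 : (0 : ℕ) ≠ N := fun h => hN.2 h.symm
    have ha0 : a = 0 := by
      simpa [hydef, hN.1, Finsupp.single_apply, hN2] using h2
    rw [ha, ha0, zero_smul, add_zero]
  exact ⟨{ LinearEquiv.ofBijective f ⟨hinj, hsurj⟩ with
    map_lie' := fun {x v} => hequi x v }⟩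

end Recognition

/-! ### Twisted modules and the images of rank one operators -/

section Twist

variable {V : Type*} [AddCommGroup V] [Module ℂ V] (e : Basis ℕ ℂ V)

theorem natural_transitive {m : V} (hm : m ≠ 0) (u : V) : ∃ x : glMInfty e, ⁅x, m⁆ = u := by
  obtain ⟨w, hw, hwm⟩ := exists_restrictedDual_ne_zero e hm
  refine ⟨rankOne e ((w m)⁻¹ • u) ⟨w, hw⟩, ?_⟩
  change w m • (w m)⁻¹ • u = u
  rw [smul_smul, mul_inv_cancel₀ hwm, one_smul]

theorem conatural_lie_apply (x : glMInfty e) (η : conaturalModule e) (v : V) :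
    ((⁅x, η⁆ : conaturalModule e) : Dual ℂ V) v = -(η : Dual ℂ V) ((x : End ℂ V) v) := by
  change (⁅x, (η : Dual ℂ V)⁆ : Dual ℂ V) v = _
  simp

theorem conatural_transitive {m : conaturalModule e} (hm : m ≠ 0) (u : conaturalModule e) :
    ∃ x : glMInfty e, ⁅x, m⁆ = u := by
  obtain ⟨v, hv⟩ : ∃ v, (m : Dual ℂ V) v ≠ 0 := by
    by_contra! h
    exact hm (Subtype.ext (LinearMap.ext h))
  refine ⟨rankOne e (-((m : Dual ℂ V) v)⁻¹ • v) ⟨u, u.2⟩, Subtype.ext (LinearMap.ext fun z => ?_)⟩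
  rw [conatural_lie_apply]
  simp [hv]

section

variable {L M N : Type*} [LieRing L] [LieAlgebra ℂ L] [AddCommGroup M]
  [LieRingModule L M] [AddCommGroup N] [Module ℂ N]
  [LieRingModule L N]

theorem twisted_transitive (h : L ≃ₗ⁅ℂ⁆ L)
    (hM : ∀ m : M, m ≠ 0 → ∀ u, ∃ x : L, ⁅x, m⁆ = u) (m : TwistedModule h M) (hm : m ≠ 0)
    (u : TwistedModule h M) : ∃ x : L, ⁅x, m⁆ = u := by
  obtain ⟨x, hx⟩ := hM m hm u
  refine ⟨h.symm x, ?_⟩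
  change @Bracket.bracket L M _ (h (h.symm x)) m = u
  rw [h.apply_symm_apply]
  exact hx

theorem nonempty_equiv_untwist [Module ℂ M] (h : L ≃ₗ⁅ℂ⁆ L)
    (hMN : Nonempty (M ≃ₗ⁅ℂ, L⁆ TwistedModule h.symm N)) :
    Nonempty (TwistedModule h M ≃ₗ⁅ℂ, L⁆ N) := by
  obtain ⟨f⟩ := hMN
  let g : TwistedModule h M ≃ₗ[ℂ] N := (f : M ≃ₗ[ℂ] TwistedModule h.symm N)
  refine ⟨{ g with map_lie' := fun {x v} => ?_ }⟩
  have h1 : f ⁅h x, (v : M)⁆ = ⁅h x, f v⁆ := LieModuleHom.map_lie f.toLieModuleHom (h x) v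
  have h2 : ⁅h x, f v⁆ = (⁅h.symm (h x), (f v : N)⁆ : N) := rfl
  rw [h.symm_apply_apply] at h2
  exact h1.trans h2

end

theorem rankOne_injective {v : V} (hv : v ≠ 0) : Function.Injective (rankOne e v) := by
  rw [injective_iff_map_eq_zero]
  intro w hw
  refine Subtype.ext (LinearMap.ext fun u => ?_)
  have h1 : (w : Dual ℂ V) u • v = 0 := by rw [← rankOne_apply, hw]; rfl
  exact (smul_eq_zero.1 h1).resolve_right hv

/-- Automorphisms of `𝔤𝔩^M_∞` send nilpotent operators of rank one to operators of rank one. -/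
theorem map_rankOne_eq_smulRight (g : glMInfty e ≃ₗ⁅ℂ⁆ glMInfty e) {v : V} (hv : v ≠ 0)
    {w : restrictedDual e} (hw : (w : Dual ℂ V) v = 0) :
    ∃ (s : V) (ω : Dual ℂ V), (g (rankOne e v w) : End ℂ V) = ω.smulRight s := by
  by_cases hw0 : w = 0
  · exact ⟨0, 0, by rw [hw0, map_zero, map_zero]; ext; simp⟩
  obtain ⟨u, hu⟩ : ∃ u, (w : Dual ℂ V) u ≠ 0 := by
    by_contra! h
    exact hw0 (Subtype.ext (LinearMap.ext h))
  obtain ⟨η, hη, hηv⟩ := exists_restrictedDual_ne_zero e hv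
  have hne : ⁅rankOne e v w, rankOne e u ⟨η, hη⟩⁆ ≠ 0 := by
    intro h
    have := congrArg (fun x : glMInfty e => (x : End ℂ V) v) h
    simp [hw, hηv, hu, hv] at this
  have hcomm : (g (rankOne e v w) : End ℂ V) * (g (rankOne e u ⟨η, hη⟩) : End ℂ V) ≠
      (g (rankOne e u ⟨η, hη⟩) : End ℂ V) * (g (rankOne e v w) : End ℂ V) := by
    intro h
    refine hne (g.injective ?_)
    change g _ = g 0
    rw [LieEquiv.map_lie, map_zero]
    exact Subtype.ext (sub_eq_zero.2 h)
  obtain ⟨z, hz0, hz⟩ := exists_ne_smul_of_not_commute hcomm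
  -- Extremality is transported by `g`: as `w v = 0`, only the middle term `-2 X y X` of `[X, [X,
  -- y]]` remains.
  refine exists_eq_smulRight_of_extremal e hz0 hz fun Y hY => ?_
  set y := g.symm ⟨Y, hY⟩ with hydef
  refine ⟨-2 * (w : Dual ℂ V) ((y : End ℂ V) v), ?_⟩
  have h1 : ⁅rankOne e v w, ⁅rankOne e v w, y⁆⁆ =
      (-2 * (w : Dual ℂ V) ((y : End ℂ V) v)) • rankOne e v w := by
    refine glMInfty_ext e fun u => ?_
    simp only [glMInfty_lie_apply, rankOne_apply, map_sub, map_smul, hw, SetLike.val_smul,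
      LinearMap.smul_apply]
    module
  have h2 := congrArg g h1
  rw [LieEquiv.map_lie, LieEquiv.map_lie, map_smul, hydef, g.apply_symm_apply] at h2
  exact congrArg (fun x : glMInfty e => (x : End ℂ V)) h2

end Twist

theorem mainTheorem3 {V : Type*} [AddCommGroup V] [Module ℂ V] (e : Module.Basis ℕ ℂ V)
    (h : glMInfty e ≃ₗ⁅ℂ⁆ glMInfty e) :
    Nonempty (TwistedModule h V ≃ₗ⁅ℂ, glMInfty e⁆ V) ∨
      Nonempty (TwistedModule h V ≃ₗ⁅ℂ, glMInfty e⁆ conaturalModule e) := by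
  let E : Submodule ℂ (restrictedDual e) :=
    LinearMap.ker (LinearMap.applyₗ (e 0) ∘ₗ (restrictedDual e).subtype)
  let R : E →+ End ℂ V := ((glMInfty e).toSubmodule.subtype ∘ₗ
    (h.symm : glMInfty e →ₗ[ℂ] glMInfty e) ∘ₗ rankOne e (e 0) ∘ₗ E.subtype).toAddMonoidHom
  have hR : ∀ w : E, R w = (h.symm (rankOne e (e 0) w) : End ℂ V) := fun _ => rfl
  have he : restrictedCoord e 1 ∈ E := by simp [E]
  have h0 : R ⟨restrictedCoord e 1, he⟩ ≠ 0 := by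
    intro h1
    have h2 : h.symm (rankOne e (e 0) (restrictedCoord e 1)) = 0 := Subtype.ext h1
    have h3 := h.symm.injective (h2.trans (map_zero h.symm).symm)
    have h4 := rankOne_injective e (e.ne_zero 0) (h3.trans (map_zero _).symm)
    simpa using congrArg (fun w : restrictedDual e => (w : Dual ℂ V) (e 1)) h4
  obtain ⟨z₀, hz₀⟩ : ∃ z, R ⟨restrictedCoord e 1, he⟩ z ≠ 0 := by
    by_contra! hall
    exact h0 (LinearMap.ext hall)
  rcases range_or_ker_of_rankOne R
    (fun w => map_rankOne_eq_smulRight e h.symm (e.ne_zero 0) w.2) h0 with ⟨m, hm⟩ | ⟨ω, hω⟩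
  · left
    refine nonempty_equiv_untwist h ?_
    exact nonempty_equiv_of_range_rankOne (M := TwistedModule h.symm V) e
      (twisted_transitive h.symm fun m hm => natural_transitive e hm) m
      (fun w hw z => hm ⟨w, hw⟩ z) (w₀ := restrictedCoord e 1) he (z₀ := z₀) hz₀
  · right
    obtain ⟨η, hη, hηz⟩ := exists_restrictedDual_ne_zero e hz₀
    obtain ⟨s, hs⟩ := hω ⟨restrictedCoord e 1, he⟩
    rw [hs, LinearMap.smulRight_apply, map_smul, smul_eq_mul] at hηz
    have hηs := right_ne_zero_of_mul hηz
    -- A common kernel a priori only gives a functional in `V^*`; it is in `V_*` because it is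
    -- proportional to the pullback of `η ∈ V_*` along an element of the algebra.
    have hωm : ω ∈ restrictedDual e := by
      have h1 := Submodule.smul_mem _ (η s)⁻¹ (comp_mem_restrictedDual e
        (h.symm (rankOne e (e 0) (restrictedCoord e 1))).2 hη)
      have h2 : ω = (η s)⁻¹ • (η ∘ₗ R ⟨restrictedCoord e 1, he⟩) := by
        rw [hs]
        ext z
        simp only [LinearMap.smul_apply, LinearMap.comp_apply, LinearMap.smulRight_apply, map_smul,
          smul_eq_mul]
        field_simp
      rw [h2]
      exact h1
    refine nonempty_equiv_untwist h ?_
    refine nonempty_equiv_of_range_rankOne (M := TwistedModule h.symm (conaturalModule e)) e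
      (twisted_transitive h.symm fun m hm => conatural_transitive e hm)
      (⟨ω, hωm⟩ : conaturalModule e) (fun w hw (z : conaturalModule e) => ?_) (w₀ := restrictedCoord e 1) he
      (z₀ := (⟨η, hη⟩ : conaturalModule e)) ?_
    · obtain ⟨s, hs⟩ := hω ⟨w, hw⟩
      refine ⟨-(z : Dual ℂ V) s, Subtype.ext (LinearMap.ext fun v => ?_)⟩
      refine (conatural_lie_apply e (h.symm (rankOne e (e 0) w)) z v).trans ?_
      rw [← hR ⟨w, hw⟩, hs, LinearMap.smulRight_apply, map_smul]
      change -(ω v * _) = -_ * ω v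
      ring
    · intro h1
      have h2 := congrArg (fun ζ : conaturalModule e => (ζ : Dual ℂ V) z₀) h1
      have h3 := (conatural_lie_apply e (h.symm (rankOne e (e 0) (restrictedCoord e 1)))
        ⟨η, hη⟩ z₀).symm.trans h2
      rw [← hR ⟨restrictedCoord e 1, he⟩, hs, LinearMap.smulRight_apply, map_smul] at h3
      exact hηz (neg_eq_zero.1 h3)
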